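/- Let $S\in\mathbb R^{N\times N}$ be a symmetric matrix (the graph shift operator of a graph $\mathcal G$ with $N$ nodes) and let $[a,b]$, $a<b$, be an interval containing the eigenvalues of $S$. Let $\Phi$ be an $L$-layer GNN $$X^{(l)}=\sigma\Big(\sum_{k=0}^{K-1}S^kX^{(l-1)}H^{(l)}_k\Big),\qquad l=1,\dots,L,\qquad X^{(0)}=q\in\mathbb R^{N},$$ with one input feature and $F$ features at every layer, so $H_k^{(1)}\in\mathbb R^{1\times F}$ and $H_k^{(l)}\in\mathbb R^{F\times F}$ for $l\ge 2$, where $\sigma:\mathbb R\to\mathbb R$ acts entrywise, is Lipschitz with constant $C_\sigma=1$, and $\sigma(0)=0$. Write $\Phi(\mathcal G,q)=X^{(L)}$. For every layer $l$ and every pair of features $(g,f)$ consider the filter with coefficients $h_k=H^{(l)}_k[g,f]$, frequency response $h(\lambda)=\sum_{k=0}^{K-1} h_k\lambda^k$ and matrix $H(S)=\sum_{k=0}^{K-1} h_kS^k$. Suppose that every one of these filters is integral Lipschitz with one constant $C>0$ on $[a,b]$, i.e. $$|h(\lambda_2)-h(\lambda_1)|\;\frac{|\lambda_1+\lambda_2|}{2}\le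 C\,|\lambda_2-\lambda_1|\qquad\text{for all }\lambda_1,\lambda_2\in[a,b],$$ and that it satisfies $\|H(S)\|\le\beta=1/F$ in the spectral norm. For operators $A,B$ that map families $x=(x_1,\dots,x_M)$ of vectors in $\mathbb R^N$ to $\mathbb R^N$, let the distance modulo permutation be $$\|A-B\|_{\mathcal P}=\min_{\Pi}\ \max_{\|x_1\|=\dots=\|x_M\|=1}\big\|\Pi^{T}A(x_1,\dots,x_M)-B(\Pi^{T}x_1,\dots,\Pi^{T}x_M)\big\|,$$ the minimum being over the $N\times N$ permutation matrices. Then there are $\kappa\in\mathbb R$ and $\varepsilon_0>0$ such that for all $0\le\varepsilon\le\varepsilon_0$, all $E\in\mathbb R^{N\times N}$ with $\|E\|\le\varepsilon$, all $M\ge1$ and every output feature $f$, with $\tilde{\mathcal G}$ the perturbed graph with shift operator $\tilde S=S+SE+ES$, the sample-averaged positional encodings, regarded as operators on the samples $(q^{(1)},\dots,q^{(M)})$, satisfy $$\Big\|\frac1M\sum_{m=1}^M\Phi(\mathcal G,q^{(m)})[:,f]-\frac1M\sum_{m=1}^M\Phi(\tilde{\mathcal G},q^{(m)})[:,f]\Big\|_{\mathcal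 P}\le 2C\,(1+8\sqrt N)\,L\,\varepsilon+\kappa\,\varepsilon^2 .$$ -/

import Mathlib

open scoped Matrix.Norms.L2Operator ENNReal

namespace Pearl

/-- The linear action `x ↦ Πᵀ x` of the transpose of the permutation matrix of `π` on graph
signals. -/
noncomputable def permT {N : ℕ} (π : Equiv.Perm (Fin N)) (x : EuclideanSpace ℝ (Fin N)) :
    EuclideanSpace ℝ (Fin N) :=
  Matrix.toEuclideanCLM (𝕜 := ℝ) (π.permMatrix ℝ).transpose x

/-- The operator distance modulo permutation
`min_Π max_{‖x_m‖ = 1} ‖Πᵀ (A x) - B (Πᵀ x)‖`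
between two (not necessarily linear) operators `A`, `B` acting on families `x = (x_m)` of graph
signals. Operators on one signal are the case of a one-element index type. The value is taken in
`ℝ≥0∞`, so that the supremum never has a junk value; the infimum is over finitely many
permutations, hence a minimum. -/
noncomputable def permDist {N : ℕ} {ι : Type*}
    (A B : (ι → EuclideanSpace ℝ (Fin N)) → EuclideanSpace ℝ (Fin N)) : ℝ≥0∞ :=
  ⨅ π : Equiv.Perm (Fin N), ⨆ x : ι → EuclideanSpace ℝ (Fin N), ⨆ _ : ∀ m, ‖x m‖ = 1,
    ‖permT π (A x) - B (fun m => permT π (x m))‖ₑ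

/-- The graph filter `H(S) = ∑_{k<K} h_k S^k`. -/
noncomputable def graphFilter {N K : ℕ} (h : Fin K → ℝ) (S : Matrix (Fin N) (Fin N) ℝ) :
    Matrix (Fin N) (Fin N) ℝ :=
  ∑ k, h k • S ^ (k : ℕ)

/-- The frequency response `h(t) = ∑_{k<K} h_k t^k`. -/
noncomputable def freqResponse {K : ℕ} (h : Fin K → ℝ) (t : ℝ) : ℝ :=
  ∑ k, h k * t ^ (k : ℕ)

/-- The filter with coefficients `h` is integral Lipschitz with constant `C` on the set `Λ` of
frequencies: `|h(t) - h(s)| ≤ C |t - s| / (|s + t| / 2)`. The denominator is multiplied out, so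
that the inequality asks for nothing when `s + t = 0` (where the quotient is infinite). -/
def IsIntegralLipschitz {K : ℕ} (h : Fin K → ℝ) (C : ℝ) (Λ : Set ℝ) : Prop :=
  ∀ s ∈ Λ, ∀ t ∈ Λ,
    |freqResponse h t - freqResponse h s| * (|s + t| / 2) ≤ C * |t - s|

/-- The weights of a GNN with polynomial filters of `K` taps and feature dimensions
`width 0, width 1, …`: the layer from `width l` to `width (l+1)` features has the matrices
`H l k`, `k < K`. -/
abbrev Weights (width : ℕ → ℕ) (K : ℕ) : Type :=
  (l : ℕ) → Fin K → Matrix (Fin (width l)) (Fin (width (l + 1))) ℝ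

/-- The GNN recursion `X^{(l+1)} = σ (∑_{k<K} S^k X^{(l)} H_k)`, with `σ` acting entrywise.
`gnn σ H S X L` is the output after `L` layers; it uses only the weights `H l` with `l < L`. -/
noncomputable def gnn {N K : ℕ} {width : ℕ → ℕ} (σ : ℝ → ℝ) (H : Weights width K)
    (S : Matrix (Fin N) (Fin N) ℝ) (X : Matrix (Fin N) (Fin (width 0)) ℝ) :
    (L : ℕ) → Matrix (Fin N) (Fin (width L)) ℝ
  | 0 => X
  | l + 1 => (∑ k : Fin K, S ^ (k : ℕ) * gnn σ H S X l * H l k).map σ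

/-- One input feature, and `F` features at every layer. -/
def pearlWidth (F : ℕ) : ℕ → ℕ
  | 0 => 1
  | _ + 1 => F

/-- A graph signal as a feature matrix with one column. -/
def asColumn {N F : ℕ} (q : EuclideanSpace ℝ (Fin N)) :
    Matrix (Fin N) (Fin (pearlWidth F 0)) ℝ :=
  Matrix.of fun i _ => q i

/-- The column `Φ(G, q)[:, f]` of the output of the `L`-layer GNN on the graph with shift operator
`S` and the initial node attributes `q`. -/
noncomputable def pearlColumn {N K F : ℕ} (σ : ℝ → ℝ) (H : Weights (pearlWidth F) K) (L : ℕ)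
    (f : Fin (pearlWidth F L)) (S : Matrix (Fin N) (Fin N) ℝ) (q : EuclideanSpace ℝ (Fin N)) :
    EuclideanSpace ℝ (Fin N) :=
  WithLp.toLp 2 fun i => gnn σ H S (asColumn q) L i f

/-- The sample-averaged positional encoding `(1/M) ∑_{m<M} Φ(G, q^{(m)})[:, f]`, as an operator on
the family `q` of samples. -/
noncomputable def averagedPE {N K F M : ℕ} (σ : ℝ → ℝ) (H : Weights (pearlWidth F) K) (L : ℕ)
    (f : Fin (pearlWidth F L)) (S : Matrix (Fin N) (Fin N) ℝ)
    (q : Fin M → EuclideanSpace ℝ (Fin N)) : EuclideanSpace ℝ (Fin N) :=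
  (1 / (M : ℝ)) • ∑ m, pearlColumn σ H L f S (q m)

end Pearl

/-! Put `T = S * E + E * S` and expand each filter at `S`: `h(S + T) = h(S) + Dh(S)[T] + O(‖T‖²)`.
In an eigenbasis of `S`, `T` has entries `(λᵢ + λⱼ) Eᵢⱼ`, and `Dh(S)` multiplies entry `(i, j)` by
the divided difference `h[λᵢ, λⱼ]`. The integral Lipschitz condition says exactly that `|h[λᵢ, λⱼ]
(λᵢ + λⱼ)| ≤ 2C`, and passing through the Frobenius norm turns this entrywise bound into `2C√N ‖E‖`
(`norm_sum_smul_powDeriv_le`). Only the spectrum of `S` enters, never that of the perturbed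
operator.

Across layers, `β = 1/F` cancels the sum over `F` features, so each layer adds one filter error and
transmits the earlier error without first-order amplification (`exists_norm_pearlColumn_sub_le`).
Averaging preserves the bound, and the identity permutation suffices. -/

namespace Pearl

/-! ### Second-order expansion of powers in a normed ring. -/

section PowerPerturbation

/-- The directional derivative of `x ↦ x ^ k` at `s` in the direction `t`, in a noncommutative
ring: `∑_{r<k} s^r t s^{k-1-r}`. -/
def powDeriv {R : Type*} [Semiring R] (s t : R) : ℕ → R
  | 0 => 0
  | k + 1 => powDeriv s t k * s + s ^ k * t

theorem map_powDeriv {R R' G : Type*} [Semiring R] [Semiring R'] [FunLike G R R']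
    [RingHomClass G R R'] (φ : G) (s t : R) (k : ℕ) :
    φ (powDeriv s t k) = powDeriv (φ s) (φ t) k := by
  induction k with
  | zero => simp [powDeriv]
  | succ k ih => simp [powDeriv, ih]

theorem exists_norm_powDeriv_le {R : Type*} [NormedRing R] (s : R) (k : ℕ) :
    ∃ c, 0 ≤ c ∧ ∀ t, ‖powDeriv s t k‖ ≤ c * ‖t‖ := by
  induction k with
  | zero => exact ⟨0, le_rfl, fun t => by simp [powDeriv]⟩
  | succ k ih =>
    obtain ⟨c, hc, h⟩ := ih
    refine ⟨c * ‖s‖ + ‖s ^ k‖, by positivity, fun t => ?_⟩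
    calc ‖powDeriv s t k * s + s ^ k * t‖
        ≤ ‖powDeriv s t k‖ * ‖s‖ + ‖s ^ k‖ * ‖t‖ :=
          (norm_add_le _ _).trans (add_le_add (norm_mul_le _ _) (norm_mul_le _ _))
      _ ≤ c * ‖t‖ * ‖s‖ + ‖s ^ k‖ * ‖t‖ := by gcongr; exact h t
      _ = (c * ‖s‖ + ‖s ^ k‖) * ‖t‖ := by ring

/-- The remainder at `k + 1` is the remainder at `k` times `s + t`, plus the derivative times `t`;
both are quadratic in `t`, uniformly on the ball of radius `r`. -/
theorem exists_norm_pow_sub_powDeriv_le {R : Type*} [NormedRing R] (s : R) (r : ℝ) (k : ℕ) :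
    ∃ c, 0 ≤ c ∧ ∀ t, ‖t‖ ≤ r → ‖(s + t) ^ k - s ^ k - powDeriv s t k‖ ≤ c * ‖t‖ ^ 2 := by
  induction k with
  | zero => exact ⟨0, le_rfl, fun t _ => by simp [powDeriv]⟩
  | succ k ih =>
    obtain ⟨c, hc, h⟩ := ih
    obtain ⟨d, hd, h'⟩ := exists_norm_powDeriv_le s k
    refine ⟨c * (‖s‖ + |r|) + d, by positivity, fun t ht => ?_⟩
    have key : (s + t) ^ (k + 1) - s ^ (k + 1) - powDeriv s t (k + 1) =
        ((s + t) ^ k - s ^ k - powDeriv s t k) * (s + t) + powDeriv s t k * t := by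
      simp only [powDeriv, pow_succ]; noncomm_ring
    have hst : ‖s + t‖ ≤ ‖s‖ + |r| :=
      (norm_add_le _ _).trans (by gcongr; exact ht.trans (le_abs_self r))
    rw [key]
    calc _ ≤ ‖(s + t) ^ k - s ^ k - powDeriv s t k‖ * ‖s + t‖ + ‖powDeriv s t k‖ * ‖t‖ :=
          (norm_add_le _ _).trans (add_le_add (norm_mul_le _ _) (norm_mul_le _ _))
      _ ≤ c * ‖t‖ ^ 2 * (‖s‖ + |r|) + d * ‖t‖ * ‖t‖ := by
          gcongr
          · exact h t ht
          · exact h' t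
      _ = (c * (‖s‖ + |r|) + d) * ‖t‖ ^ 2 := by ring

end PowerPerturbation

/-! ### Operator norm against Frobenius norm. -/

section Frobenius

variable {N : ℕ}

theorem l2_opNorm_sq_le_sum (A : Matrix (Fin N) (Fin N) ℝ) :
    ‖A‖ ^ 2 ≤ ∑ i, ∑ j, A i j ^ 2 := by
  have h0 : 0 ≤ ∑ i, ∑ j, A i j ^ 2 := by positivity
  rw [← Real.le_sqrt (norm_nonneg _) h0, ← Matrix.l2_opNorm_toEuclideanCLM]
  refine ContinuousLinearMap.opNorm_le_bound _ (Real.sqrt_nonneg _) fun x => ?_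
  rw [EuclideanSpace.norm_eq, EuclideanSpace.norm_eq, ← Real.sqrt_mul h0]
  refine Real.sqrt_le_sqrt ?_
  rw [Finset.sum_mul]
  refine Finset.sum_le_sum fun i _ => ?_
  simp only [Matrix.ofLp_toEuclideanCLM, Real.norm_eq_abs, sq_abs]
  exact Finset.sum_mul_sq_le_sq_mul_sq Finset.univ (A i) x.ofLp

/-- Each of the `N` columns is the image of a unit basis vector. -/
theorem sum_sq_le_l2_opNorm_sq (A : Matrix (Fin N) (Fin N) ℝ) :
    ∑ i, ∑ j, A i j ^ 2 ≤ N * ‖A‖ ^ 2 := by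
  rw [Finset.sum_comm]
  have h : ∀ j : Fin N, ∑ i, A i j ^ 2 ≤ ‖A‖ ^ 2 := fun j => by
    have := (Matrix.toEuclideanCLM (𝕜 := ℝ) A).le_opNorm (EuclideanSpace.single j 1)
    rw [Matrix.l2_opNorm_toEuclideanCLM, PiLp.norm_single, norm_one, mul_one,
      EuclideanSpace.norm_eq, Real.sqrt_le_left (norm_nonneg _)] at this
    simpa [Matrix.ofLp_toEuclideanCLM, Real.norm_eq_abs, sq_abs] using this
  simpa using Finset.sum_le_sum fun j (_ : j ∈ Finset.univ) => h j

/-- A Schur multiplier with entries bounded by `c` has operator norm at most `c √N`. -/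
theorem norm_le_of_entrywise_le {c : ℝ} (hc : 0 ≤ c) (A B : Matrix (Fin N) (Fin N) ℝ)
    (h : ∀ i j, |A i j| ≤ c * |B i j|) : ‖A‖ ≤ c * √N * ‖B‖ := by
  refine (sq_le_sq₀ (norm_nonneg _) (by positivity)).1 ?_
  calc ‖A‖ ^ 2 ≤ ∑ i, ∑ j, A i j ^ 2 := l2_opNorm_sq_le_sum A
    _ ≤ ∑ i, ∑ j, c ^ 2 * B i j ^ 2 := by
        refine Finset.sum_le_sum fun i _ => Finset.sum_le_sum fun j _ => ?_
        rw [← sq_abs (A i j), ← sq_abs (B i j), ← mul_pow]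
        exact pow_le_pow_left₀ (abs_nonneg _) (h i j) 2
    _ = c ^ 2 * ∑ i, ∑ j, B i j ^ 2 := by simp only [Finset.mul_sum]
    _ ≤ c ^ 2 * (N * ‖B‖ ^ 2) := by gcongr; exact sum_sq_le_l2_opNorm_sq B
    _ = (c * √N * ‖B‖) ^ 2 := by rw [mul_pow, mul_pow, Real.sq_sqrt (Nat.cast_nonneg N)]; ring

end Frobenius

/-! ### Divided differences and the integral Lipschitz condition. -/

section DividedDifference

/-- The divided difference `∑_{r<k} x^r y^{k-1-r}` of the monomial `x^k`. -/
def powDivDiff (x y : ℝ) : ℕ → ℝ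
  | 0 => 0
  | k + 1 => powDivDiff x y k * y + x ^ k

theorem powDivDiff_mul_sub (x y : ℝ) (k : ℕ) :
    powDivDiff x y k * (x - y) = x ^ k - y ^ k := by
  induction k with
  | zero => simp [powDivDiff]
  | succ k ih => simp only [powDivDiff]; linear_combination y * ih

theorem continuous_powDivDiff (y : ℝ) (k : ℕ) : Continuous fun x => powDivDiff x y k := by
  induction k with
  | zero => exact continuous_const
  | succ k ih => simp only [powDivDiff]; fun_prop

/-- For `x ≠ y`, divide the hypothesis by `|x - y|`. The diagonal case, needed for `i = j` and
repeated eigenvalues, follows by continuity in `x`. -/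
theorem IsIntegralLipschitz.abs_divDiff_mul_add_le {K : ℕ} {h : Fin K → ℝ} {C a b : ℝ}
    (hab : a < b) (hh : IsIntegralLipschitz h C (Set.Icc a b)) {x y : ℝ}
    (hx : x ∈ Set.Icc a b) (hy : y ∈ Set.Icc a b) :
    |(∑ k, h k * powDivDiff x y k) * (x + y)| ≤ 2 * C := by
  have hne : ∀ z ∈ Set.Icc a b, z ≠ y → |(∑ k, h k * powDivDiff z y k) * (z + y)| ≤ 2 * C := by
    intro z hz hzy
    have hpos : 0 < |z - y| := abs_pos.2 (sub_ne_zero.2 hzy)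
    have heq : freqResponse h z - freqResponse h y = (∑ k, h k * powDivDiff z y k) * (z - y) := by
      simp only [freqResponse, ← Finset.sum_sub_distrib, Finset.sum_mul, ← mul_sub,
        ← powDivDiff_mul_sub, mul_assoc]
    have := hh y hy z hz
    rw [heq, abs_mul, add_comm y z] at this
    rw [abs_mul]
    refine le_of_mul_le_mul_right ?_ hpos
    linarith
  have hcont : Continuous fun z => |(∑ k, h k * powDivDiff z y k) * (z + y)| := by
    have := fun k : ℕ => continuous_powDivDiff y k
    fun_prop
  have hsub : Set.Icc a b ⊆ {z | |(∑ k, h k * powDivDiff z y k) * (z + y)| ≤ 2 * C} := by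
    -- Here `a < b` matters: `y` must not be isolated in the interval.
    have hcl : Set.Icc a b ⊆ closure (Set.Icc a b \ {y}) := by
      have hd : Dense ({y}ᶜ : Set ℝ) := dense_compl_singleton y
      conv_lhs => rw [← closure_Ioo hab.ne]
      refine closure_minimal ?_ isClosed_closure
      exact (hd.open_subset_closure_inter isOpen_Ioo).trans
        (closure_mono fun z hz => ⟨Set.Ioo_subset_Icc_self hz.1, hz.2⟩)
    exact hcl.trans (closure_minimal (fun z hz => hne z hz.1 hz.2)
      (isClosed_le hcont continuous_const))
  exact hsub hx

end DividedDifference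

/-! ### Stability of a single filter. -/

section FilterStability

variable {N K : ℕ}

theorem powDeriv_diagonal_apply (d : Fin N → ℝ) (T : Matrix (Fin N) (Fin N) ℝ) (k : ℕ)
    (i j : Fin N) :
    powDeriv (Matrix.diagonal d) T k i j = powDivDiff (d i) (d j) k * T i j := by
  induction k with
  | zero => simp [powDeriv, powDivDiff]
  | succ k ih =>
    simp only [powDeriv, powDivDiff, Matrix.add_apply, Matrix.mul_diagonal, ih,
      Matrix.diagonal_pow, Matrix.diagonal_mul, Pi.pow_apply]
    ring

/-- The first-order term of a graph filter under a relative perturbation. -/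
theorem norm_sum_smul_powDeriv_le {S : Matrix (Fin N) (Fin N) ℝ} (hS : S.IsSymm) {a b : ℝ}
    (hab : a < b) (hspec : spectrum ℝ S ⊆ Set.Icc a b) {C : ℝ} (hC : 0 ≤ C) {h : Fin K → ℝ}
    (hh : IsIntegralLipschitz h C (Set.Icc a b)) (E : Matrix (Fin N) (Fin N) ℝ) :
    ‖∑ k, h k • powDeriv S (S * E + E * S) k‖ ≤ 2 * C * √N * ‖E‖ := by
  have hH : S.IsHermitian := (Matrix.conjTranspose_eq_transpose_of_trivial S).trans hS
  -- Conjugation by the eigenvector matrix: an isometric algebra automorphism that diagonalizes `S`.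
  set φ := Unitary.conjStarAlgAut ℝ (Matrix (Fin N) (Fin N) ℝ) (star hH.eigenvectorUnitary)
  have hnorm : ∀ A, ‖φ A‖ = ‖A‖ := fun A => by
    simp only [φ, Unitary.conjStarAlgAut_apply, ← Unitary.coe_star]
    rw [CStarRing.norm_mul_coe_unitary, CStarRing.norm_coe_unitary_mul]
  have hφS : φ S = Matrix.diagonal hH.eigenvalues := hH.conjStarAlgAut_star_eigenvectorUnitary
  have hmem : ∀ i, hH.eigenvalues i ∈ Set.Icc a b := fun i =>
    hspec (hH.eigenvalues_mem_spectrum_real i)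
  rw [← hnorm, ← hnorm E]
  refine norm_le_of_entrywise_le (by positivity) _ _ fun i j => ?_
  have hval : φ (∑ k, h k • powDeriv S (S * E + E * S) k) i j =
      (∑ k, h k * powDivDiff (hH.eigenvalues i) (hH.eigenvalues j) k) *
        (hH.eigenvalues i + hH.eigenvalues j) * φ E i j := by
    simp only [map_sum, map_smul, map_powDeriv, map_add, map_mul, hφS, Matrix.sum_apply,
      Matrix.smul_apply, powDeriv_diagonal_apply, Matrix.add_apply, Matrix.mul_diagonal,
      Matrix.diagonal_mul, smul_eq_mul, Finset.sum_mul]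
    exact Finset.sum_congr rfl fun k _ => by ring
  rw [hval, abs_mul]
  gcongr
  exact hh.abs_divDiff_mul_add_le hab (hmem i) (hmem j)

/-- Stability of an integral Lipschitz graph filter under relative perturbations. -/
theorem exists_norm_graphFilter_sub_le {S : Matrix (Fin N) (Fin N) ℝ} (hS : S.IsSymm) {a b : ℝ}
    (hab : a < b) (hspec : spectrum ℝ S ⊆ Set.Icc a b) {C : ℝ} (hC : 0 ≤ C) {h : Fin K → ℝ}
    (hh : IsIntegralLipschitz h C (Set.Icc a b)) :
    ∃ κ, 0 ≤ κ ∧ ∀ ε ≤ 1, ∀ E : Matrix (Fin N) (Fin N) ℝ, ‖E‖ ≤ ε →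
      ‖graphFilter h (S + S * E + E * S) - graphFilter h S‖ ≤ 2 * C * √N * ε + κ * ε ^ 2 := by
  -- The radius `2 * ‖S‖` bounds `‖S * E + E * S‖` when `ε ≤ 1`.
  choose c hc hcr using fun k : Fin K =>
    exists_norm_pow_sub_powDeriv_le S (2 * ‖S‖) (k : ℕ)
  refine ⟨∑ k, |h k| * c k * (2 * ‖S‖) ^ 2,
    Finset.sum_nonneg fun k _ => by have := hc k; positivity, fun ε hε E hE => ?_⟩
  have hE0 := norm_nonneg E
  have hT : ‖S * E + E * S‖ ≤ 2 * ‖S‖ * ε :=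
    calc ‖S * E + E * S‖ ≤ ‖S‖ * ‖E‖ + ‖E‖ * ‖S‖ :=
          (norm_add_le _ _).trans (add_le_add (norm_mul_le _ _) (norm_mul_le _ _))
      _ = 2 * ‖S‖ * ‖E‖ := by ring
      _ ≤ 2 * ‖S‖ * ε := by gcongr
  have hT' : ‖S * E + E * S‖ ≤ 2 * ‖S‖ := hT.trans (mul_le_of_le_one_right (by positivity) hε)
  have heq : graphFilter h (S + S * E + E * S) - graphFilter h S =
      ∑ k, h k • powDeriv S (S * E + E * S) k +
        ∑ k, h k • ((S + (S * E + E * S)) ^ (k : ℕ) - S ^ (k : ℕ) -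
          powDeriv S (S * E + E * S) k) := by
    simp only [graphFilter, ← Finset.sum_sub_distrib, ← Finset.sum_add_distrib, add_assoc]
    exact Finset.sum_congr rfl fun k _ => by simp only [smul_sub]; abel
  rw [heq]
  refine (norm_add_le _ _).trans (add_le_add ?_ ?_)
  · exact (norm_sum_smul_powDeriv_le hS hab hspec hC hh E).trans (by gcongr)
  · rw [Finset.sum_mul]
    refine norm_sum_le_of_le _ fun k _ => ?_
    rw [norm_smul, Real.norm_eq_abs, mul_assoc, mul_assoc]
    gcongr
    refine (hcr k _ hT').trans ?_
    rw [← mul_pow]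
    have := hc k
    gcongr

end FilterStability

/-! ### Propagation of the error through layers and averaging. -/

section Layers

variable {N K F : ℕ} {σ : ℝ → ℝ}

theorem norm_map_sub_map_le (hσ : LipschitzWith 1 σ) (u v : EuclideanSpace ℝ (Fin N)) :
    ‖WithLp.toLp 2 (fun i => σ (u i)) - WithLp.toLp 2 (fun i => σ (v i))‖ ≤ ‖u - v‖ := by
  rw [EuclideanSpace.norm_eq, EuclideanSpace.norm_eq]
  refine Real.sqrt_le_sqrt (Finset.sum_le_sum fun i _ => ?_)
  have := hσ.dist_le_mul (u i) (v i)
  simp only [NNReal.coe_one, one_mul, Real.dist_eq] at this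
  simpa [sq_abs] using pow_le_pow_left₀ (abs_nonneg _) this 2

theorem norm_map_le (hσ : LipschitzWith 1 σ) (hσ0 : σ 0 = 0) (u : EuclideanSpace ℝ (Fin N)) :
    ‖WithLp.toLp 2 (fun i => σ (u i))‖ ≤ ‖u‖ := by
  have h := norm_map_sub_map_le hσ u 0
  have h0 : WithLp.toLp 2 (fun i => σ ((0 : EuclideanSpace ℝ (Fin N)) i)) = 0 := by
    ext i; simp [hσ0]
  rwa [h0, sub_zero, sub_zero] at h

theorem pearlColumn_zero (H : Weights (pearlWidth F) K) (f : Fin (pearlWidth F 0))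
    (S : Matrix (Fin N) (Fin N) ℝ) (q : EuclideanSpace ℝ (Fin N)) :
    pearlColumn σ H 0 f S q = q := by
  ext i; simp [pearlColumn, gnn, asColumn]

theorem pearlColumn_succ (H : Weights (pearlWidth F) K) (l : ℕ) (f : Fin (pearlWidth F (l + 1)))
    (S : Matrix (Fin N) (Fin N) ℝ) (q : EuclideanSpace ℝ (Fin N)) :
    pearlColumn σ H (l + 1) f S q = WithLp.toLp 2 fun i => σ ((∑ g,
      Matrix.toEuclideanCLM (𝕜 := ℝ) (graphFilter (fun k => H l k g f) S)
        (pearlColumn σ H l g S q)) i) := by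
  ext i
  simp only [pearlColumn, gnn, Matrix.map_apply, Matrix.sum_apply, Matrix.mul_apply,
    WithLp.ofLp_sum, Finset.sum_apply, Matrix.toEuclideanCLM_toLp, graphFilter, Matrix.mulVec,
    dotProduct, Matrix.smul_apply, smul_eq_mul, Finset.sum_mul]
  congr 1
  rw [Finset.sum_comm]
  refine Finset.sum_congr rfl fun g _ => ?_
  rw [Finset.sum_comm]
  refine Finset.sum_congr rfl fun k _ => Finset.sum_congr rfl fun j _ => ?_
  ring

theorem norm_toEuclideanCLM_apply_le (A : Matrix (Fin N) (Fin N) ℝ)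
    (x : EuclideanSpace ℝ (Fin N)) : ‖Matrix.toEuclideanCLM (𝕜 := ℝ) A x‖ ≤ ‖A‖ * ‖x‖ := by
  simpa only [Matrix.l2_opNorm_toEuclideanCLM] using
    (Matrix.toEuclideanCLM (𝕜 := ℝ) A).le_opNorm x

/-- An inequality, so as to include `F = 0`, where `1 / F` is `0`. -/
theorem nat_mul_one_div_le_one (F : ℕ) : (F : ℝ) * (1 / F) ≤ 1 := by
  rw [mul_one_div]; exact div_self_le_one _

/-- The sum over features is the quantity that survives the change of width: one unit signal at the
input, then `F` features of norm at most `1 / F`. -/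
theorem sum_norm_pearlColumn_le_one (hσ : LipschitzWith 1 σ) (hσ0 : σ 0 = 0)
    {H : Weights (pearlWidth F) K} {S : Matrix (Fin N) (Fin N) ℝ} {L : ℕ}
    (hβ : ∀ l < L, ∀ g f, ‖graphFilter (fun k => H l k g f) S‖ ≤ 1 / (F : ℝ))
    {q : EuclideanSpace ℝ (Fin N)} (hq : ‖q‖ = 1) :
    ∀ l ≤ L, ∑ g, ‖pearlColumn σ H l g S q‖ ≤ 1 := by
  intro l
  induction l with
  | zero =>
    intro _
    simp only [pearlColumn_zero, hq, Finset.sum_const, Finset.card_univ, Fintype.card_fin]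
    simp [pearlWidth]
  | succ l ih =>
    intro hl
    have hf : ∀ f, ‖pearlColumn σ H (l + 1) f S q‖ ≤ 1 / (F : ℝ) := fun f => by
      rw [pearlColumn_succ]
      refine (norm_map_le hσ hσ0 _).trans ?_
      calc _ ≤ ∑ g, 1 / (F : ℝ) * ‖pearlColumn σ H l g S q‖ :=
            norm_sum_le_of_le _ fun g _ => (norm_toEuclideanCLM_apply_le _ _).trans
              (mul_le_mul_of_nonneg_right (hβ l hl g f) (norm_nonneg _))
        _ ≤ 1 / (F : ℝ) := by
            rw [← Finset.mul_sum]
            exact mul_le_of_le_one_right (by positivity) (ih (by omega))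
    calc _ ≤ ∑ _g : Fin (pearlWidth F (l + 1)), 1 / (F : ℝ) := Finset.sum_le_sum fun f _ => hf f
      _ = F * (1 / F) := by
        rw [Finset.sum_const, Finset.card_univ, Fintype.card_fin, nsmul_eq_mul]; rfl
      _ ≤ 1 := nat_mul_one_div_le_one F

/-- One layer: a perturbation of size `Δ` of the filters adds at most `Δ` to the error. -/
theorem norm_pearlColumn_succ_sub_le (hσ : LipschitzWith 1 σ)
    {H : Weights (pearlWidth F) K} {S S' : Matrix (Fin N) (Fin N) ℝ} {l : ℕ}
    {f : Fin (pearlWidth F (l + 1))} {Δ : ℝ} (hΔ : 0 ≤ Δ)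
    (hβ : ∀ g, ‖graphFilter (fun k => H l k g f) S‖ ≤ 1 / (F : ℝ))
    (hd : ∀ g, ‖graphFilter (fun k => H l k g f) S' - graphFilter (fun k => H l k g f) S‖ ≤ Δ)
    {q : EuclideanSpace ℝ (Fin N)} (hq : ∑ g, ‖pearlColumn σ H l g S q‖ ≤ 1) :
    ‖pearlColumn σ H (l + 1) f S q - pearlColumn σ H (l + 1) f S' q‖ ≤
      Δ + (1 / F + Δ) * ∑ g, ‖pearlColumn σ H l g S q - pearlColumn σ H l g S' q‖ := by
  rw [pearlColumn_succ, pearlColumn_succ]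
  refine (norm_map_sub_map_le hσ _ _).trans ?_
  rw [← Finset.sum_sub_distrib]
  set A := fun g => graphFilter (fun k => H l k g f) S
  set A' := fun g => graphFilter (fun k => H l k g f) S'
  set x := fun g => pearlColumn σ H l g S q
  set x' := fun g => pearlColumn σ H l g S' q
  have hA' : ∀ g, ‖A' g‖ ≤ 1 / F + Δ := fun g => by
    calc ‖A' g‖ = ‖A g + (A' g - A g)‖ := by rw [add_sub_cancel]
      _ ≤ 1 / F + Δ := (norm_add_le _ _).trans (add_le_add (hβ g) (hd g))
  calc _ ≤ ∑ g, (Δ * ‖x g‖ + (1 / F + Δ) * ‖x g - x' g‖) := by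
        refine norm_sum_le_of_le _ fun g _ => ?_
        -- The filter error acts on the unperturbed features, whose norms sum to at most `1`; the
        -- perturbed filter acts on the feature error.
        have : Matrix.toEuclideanCLM (𝕜 := ℝ) (A g) (x g) -
            Matrix.toEuclideanCLM (𝕜 := ℝ) (A' g) (x' g) =
            -Matrix.toEuclideanCLM (𝕜 := ℝ) (A' g - A g) (x g) +
              Matrix.toEuclideanCLM (𝕜 := ℝ) (A' g) (x g - x' g) := by
          simp only [map_sub, sub_apply]; abel
        change ‖Matrix.toEuclideanCLM (𝕜 := ℝ) (A g) (x g) -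
            Matrix.toEuclideanCLM (𝕜 := ℝ) (A' g) (x' g)‖ ≤ _
        rw [this]
        refine (norm_add_le _ _).trans (add_le_add ?_ ?_)
        · rw [norm_neg]
          exact (norm_toEuclideanCLM_apply_le _ _).trans
            (mul_le_mul_of_nonneg_right (hd g) (norm_nonneg _))
        · exact (norm_toEuclideanCLM_apply_le _ _).trans
            (mul_le_mul_of_nonneg_right (hA' g) (norm_nonneg _))
    _ = Δ * ∑ g, ‖x g‖ + (1 / F + Δ) * ∑ g, ‖x g - x' g‖ := by
        rw [Finset.sum_add_distrib, Finset.mul_sum, Finset.mul_sum]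
    _ ≤ _ := by
        gcongr
        exact mul_le_of_le_one_right hΔ hq

/-- Stability of the output of `l` layers with filters that are stable to first order `B ε`. -/
theorem exists_norm_pearlColumn_sub_le (hσ : LipschitzWith 1 σ) (hσ0 : σ 0 = 0)
    {H : Weights (pearlWidth F) K} {S : Matrix (Fin N) (Fin N) ℝ} {L : ℕ}
    (hβ : ∀ l < L, ∀ g f, ‖graphFilter (fun k => H l k g f) S‖ ≤ 1 / (F : ℝ))
    {B : ℝ} (hB : 0 ≤ B)
    (hstab : ∀ l < L, ∀ g f, ∃ κ, 0 ≤ κ ∧ ∀ ε ≤ 1, ∀ E : Matrix (Fin N) (Fin N) ℝ, ‖E‖ ≤ ε →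
      ‖graphFilter (fun k => H l k g f) (S + S * E + E * S) -
        graphFilter (fun k => H l k g f) S‖ ≤ B * ε + κ * ε ^ 2) :
    ∀ l ≤ L, ∃ κ, 0 ≤ κ ∧ ∀ ε ≤ 1, ∀ E : Matrix (Fin N) (Fin N) ℝ, ‖E‖ ≤ ε →
      ∀ q : EuclideanSpace ℝ (Fin N), ‖q‖ = 1 → ∀ f,
        ‖pearlColumn σ H l f S q - pearlColumn σ H l f (S + S * E + E * S) q‖ ≤
          B * l * ε + κ * ε ^ 2 := by
  intro l
  induction l with
  | zero => exact fun _ => ⟨0, le_rfl, fun ε _ E _ q _ f => by simp [pearlColumn_zero]⟩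
  | succ l ih =>
    intro hl
    obtain ⟨κ, hκ, ih⟩ := ih (by omega)
    choose c hc hcd using hstab l hl
    set c₀ := ∑ g, ∑ f, c g f
    have hc₀ : 0 ≤ c₀ := Finset.sum_nonneg fun g _ => Finset.sum_nonneg fun f _ => hc g f
    have hcle : ∀ g f, c g f ≤ c₀ := fun g f =>
      (Finset.single_le_sum (f := fun f => c g f) (fun f _ => hc g f) (Finset.mem_univ f)).trans
        (Finset.single_le_sum (f := fun g => ∑ f, c g f)
          (fun g _ => Finset.sum_nonneg fun f _ => hc g f) (Finset.mem_univ g))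
    -- `c₀` comes from this layer's filters and `κ` from the earlier layers; the last term bounds
    -- the cross term `Δ * F * D`, using `ε ^ 2 ≤ ε` in each factor.
    refine ⟨c₀ + κ + (B + c₀) * F * (B * l + κ), by positivity, fun ε hε E hE q hq f => ?_⟩
    have hε0 : 0 ≤ ε := (norm_nonneg E).trans hE
    set Δ := B * ε + c₀ * ε ^ 2
    have hΔ : 0 ≤ Δ := by positivity
    set D := B * l * ε + κ * ε ^ 2
    have hD : 0 ≤ D := by positivity
    have hstep := norm_pearlColumn_succ_sub_le hσ hΔ (f := f) (fun g => hβ l hl g f)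
      (fun g => (hcd g f ε hε E hE).trans
        (add_le_add_right (mul_le_mul_of_nonneg_right (hcle g f) (sq_nonneg ε)) _))
      (sum_norm_pearlColumn_le_one hσ hσ0 hβ hq l (by omega))
    have hsum : ∑ g, ‖pearlColumn σ H l g S q - pearlColumn σ H l g (S + S * E + E * S) q‖ ≤
        F * D := by
      -- The input has width `1`, not `F`, but it is the same on both graphs and carries no error.
      cases l with
      | zero =>
        simp only [pearlColumn_zero, sub_self, norm_zero, Finset.sum_const_zero]
        positivity
      | succ l =>
        calc _ ≤ ∑ _g : Fin (pearlWidth F (l + 1)), D :=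
              Finset.sum_le_sum fun g _ => ih ε hε E hE q hq g
          _ = F * D := by
            rw [Finset.sum_const, Finset.card_univ, Fintype.card_fin, nsmul_eq_mul]; rfl
    have hsq : ε ^ 2 ≤ ε := by nlinarith
    have hΔ' : Δ ≤ (B + c₀) * ε := by
      have := mul_le_mul_of_nonneg_left hsq hc₀
      simp only [Δ]; linarith
    have hD' : D ≤ (B * l + κ) * ε := by
      have := mul_le_mul_of_nonneg_left hsq hκ
      simp only [D]; linarith
    calc _ ≤ Δ + (1 / F + Δ) * (F * D) := hstep.trans (by gcongr)
      _ = Δ + F * (1 / F) * D + Δ * F * D := by ring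
      _ ≤ Δ + 1 * D + (B + c₀) * ε * F * ((B * l + κ) * ε) := by
          gcongr
          exact nat_mul_one_div_le_one F
      _ = _ := by simp only [Δ, D]; push_cast; ring

theorem norm_averagedPE_sub_le {M L : ℕ} (hM : 1 ≤ M) {H : Weights (pearlWidth F) K}
    {S S' : Matrix (Fin N) (Fin N) ℝ} {f : Fin (pearlWidth F L)}
    {q : Fin M → EuclideanSpace ℝ (Fin N)} {D : ℝ}
    (h : ∀ m, ‖pearlColumn σ H L f S (q m) - pearlColumn σ H L f S' (q m)‖ ≤ D) :
    ‖averagedPE σ H L f S q - averagedPE σ H L f S' q‖ ≤ D := by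
  have hM' : (0 : ℝ) < M := by exact_mod_cast hM
  rw [averagedPE, averagedPE, ← smul_sub, ← Finset.sum_sub_distrib, norm_smul,
    Real.norm_of_nonneg (by positivity), one_div, inv_mul_le_iff₀ hM']
  simpa using norm_sum_le_of_le Finset.univ fun m _ => h m

end Layers

/-! ### Distance modulo permutation and conclusion. -/

theorem permT_one {N : ℕ} (x : EuclideanSpace ℝ (Fin N)) : permT 1 x = x := by
  simp [permT]

theorem permDist_le_ofReal {N : ℕ} {ι : Type*}
    {A B : (ι → EuclideanSpace ℝ (Fin N)) → EuclideanSpace ℝ (Fin N)} {r : ℝ}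
    (h : ∀ x, (∀ m, ‖x m‖ = 1) → ‖A x - B x‖ ≤ r) : permDist A B ≤ ENNReal.ofReal r := by
  refine (iInf_le _ 1).trans (iSup₂_le fun x hx => ?_)
  simp only [permT_one]
  rw [← ofReal_norm]
  exact ENNReal.ofReal_le_ofReal (h x hx)

end Pearl

theorem mainTheorem8 (N K F L : ℕ)
    (S : Matrix (Fin N) (Fin N) ℝ) (hS : S.IsSymm)
    (a b : ℝ) (hab : a < b) (hspec : spectrum ℝ S ⊆ Set.Icc a b)
    (σ : ℝ → ℝ) (hσ : LipschitzWith 1 σ) (hσ0 : σ 0 = 0)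
    (H : Pearl.Weights (Pearl.pearlWidth F) K)
    (C : ℝ) (hC : 0 < C)
    (hIL : ∀ l < L, ∀ g f, Pearl.IsIntegralLipschitz (fun k => H l k g f) C (Set.Icc a b))
    (hβ : ∀ l < L, ∀ g f, ‖Pearl.graphFilter (fun k => H l k g f) S‖ ≤ 1 / (F : ℝ)) :
    ∃ κ ε₀ : ℝ, 0 < ε₀ ∧
      ∀ ε : ℝ, 0 ≤ ε → ε ≤ ε₀ →
      ∀ E : Matrix (Fin N) (Fin N) ℝ, ‖E‖ ≤ ε →
      ∀ (M : ℕ), 1 ≤ M → ∀ f : Fin (Pearl.pearlWidth F L),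
        Pearl.permDist
            (Pearl.averagedPE (M := M) σ H L f S)
            (Pearl.averagedPE (M := M) σ H L f (S + S * E + E * S))
          ≤ ENNReal.ofReal (2 * C * (1 + 8 * √(N : ℝ)) * L * ε + κ * ε ^ 2) := by
  obtain ⟨κ, -, h⟩ := Pearl.exists_norm_pearlColumn_sub_le hσ hσ0 hβ
    (B := 2 * C * √(N : ℝ)) (by positivity)
    (fun l hl g f => Pearl.exists_norm_graphFilter_sub_le hS hab hspec hC.le (hIL l hl g f))
    L le_rfl
  refine ⟨κ, 1, one_pos, fun ε hε0 hε E hE M hM f => Pearl.permDist_le_ofReal fun q hq =>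
    Pearl.norm_averagedPE_sub_le hM fun m => (h ε hε E hE (q m) (hq m) f).trans ?_⟩
  -- The argument gives the sharper factor `√N` in place of `1 + 8√N`.
  have := Real.sqrt_nonneg (N : ℝ)
  gcongr
  linarith
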